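/- A metric space $X$ is called injective if for every isometric embedding $i\colon A\to B$ of metric spaces ($A$ possibly empty, so that $X\neq\emptyset$) and every $1$-Lipschitz map $f\colon A\to X$ there is a $1$-Lipschitz map $g\colon B\to X$ with $g\circ i=f$. An action $\Phi\colon G\to\mathrm{Isom}(X)$ of a group $G$ on a metric space $X$ is called geometric if it is proper, i.e. for every $x\in X$ there is a real $r>0$ such that $\{g\in G\mid \Phi(g)(B_r(x))\cap B_r(x)\neq\emptyset\}$ is finite, and cocompact, i.e. there is a compact $K\subseteq X$ with $\bigcup_{g\in G}\Phi(g)(K)=X$. A group is called metrically injective if it acts geometrically on an injective metric space. A group $H$ is called almost divisible if there is an unbounded sequence $(n_i)_{i\in\mathbb{N}}$ of positive integers such that for each $i$ every $h\in H$ has the form $h=d^{\,n_i}$ with $d\in H$. Let $G$ be a metrically injective group. Then every almost divisible subgroup $H\leq G$ is a torsion group, i.e. each of its elements has finite order. In particular, $G$ has no subgroup isomorphic to the additive group $\mathbb{Q}$ and, for every prime $p$, no subgroup isomorphic to the additive group $\mathbb{Z}_p$ of $p$-adic integers. -/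

import Mathlib

universe u v

/-- A metric space `X` is injective: it is an injective object in the category of metric spaces
and `1`-Lipschitz maps, with respect to isometric embeddings. The space `A` may be empty, so an
injective metric space is nonempty. Test spaces in the universe of `X` suffice, since there `X`
can already be compared with its one-point metric extensions. -/
def IsInjectiveMetricSpace (X : Type v) [MetricSpace X] : Prop :=
  ∀ (A B : Type v) [MetricSpace A] [MetricSpace B] (i : A → B) (f : A → X),
    Isometry i → LipschitzWith 1 f → ∃ g : B → X, LipschitzWith 1 g ∧ g ∘ i = f

/-- An action by isometries is proper: every point `x` has a ball `B_r(x)`, `r > 0`, that meets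
only finitely many of its translates (counted by group elements). -/
def IsProperIsometricAction {G : Type u} [Group G] {X : Type v} [MetricSpace X]
    (Φ : G →* (X ≃ᵢ X)) : Prop :=
  ∀ x : X, ∃ r : ℝ, 0 < r ∧
    {g : G | ((Φ g '' Metric.ball x r) ∩ Metric.ball x r).Nonempty}.Finite

/-- An action by isometries is cocompact: the translates of some compact set cover the space. -/
def IsCocompactIsometricAction {G : Type u} [Group G] {X : Type v} [MetricSpace X]
    (Φ : G →* (X ≃ᵢ X)) : Prop :=
  ∃ K : Set X, IsCompact K ∧ (⋃ g : G, Φ g '' K) = Set.univ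

/-- A geometric action: proper and cocompact, by isometries. -/
def IsGeometricAction {G : Type u} [Group G] {X : Type v} [MetricSpace X]
    (Φ : G →* (X ≃ᵢ X)) : Prop :=
  IsProperIsometricAction Φ ∧ IsCocompactIsometricAction Φ

/-- A group is metrically injective if it acts geometrically on an injective metric space. -/
def IsMetricallyInjective (G : Type u) [Group G] : Prop :=
  ∃ (X : Type v) (_ : MetricSpace X) (Φ : G →* (X ≃ᵢ X)),
    IsInjectiveMetricSpace X ∧ IsGeometricAction Φ

/-- Every element of the group is an `n`-th power (used for `n > 0` only). -/
def IsNDivisible (G : Type u) [Group G] (n : ℕ) : Prop :=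
  ∀ g : G, ∃ h : G, h ^ n = g

/-- A group is almost divisible if it is `n i`-divisible for all members of some unbounded
sequence `n` of positive natural numbers. -/
def IsAlmostDivisible (G : Type u) [Group G] : Prop :=
  ∃ n : ℕ → ℕ, ¬ BddAbove (Set.range n) ∧ ∀ i, 0 < n i ∧ IsNDivisible G (n i)

/-! If `h = d ^ n`, the orbit of `x` under `d` drifts by only `dist x (h x) / n` per step on
average. Injectivity turns this average into a point that `d` really moves that little
(`IsInjectiveMetricSpace.exists_dist_le`): averaged distances to `x` along the orbit are almost
`d`-invariant, and an isometry-equivariant `1`-Lipschitz retraction sends them to an extremal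
function, hence to the distance from a point. For a geometric action, displacement below a uniform
`δ` forces finite order (`IsGeometricAction.exists_bound`), so for large `n` the root `d`, and with
it `h`, is torsion. -/

section InjectiveHull

variable {X : Type v} [MetricSpace X]

/-- Membership in the space `Δ(X)` of functions with `d(z, w) ≤ f z + f w`. -/
def DominatesDist (f : X → ℝ) : Prop :=
  ∀ z w, dist z w ≤ f z + f w

/-- The conjugate `f*(z) = sup_w (d(z, w) - f w)`. -/
noncomputable def distConj (f : X → ℝ) (z : X) : ℝ :=
  ⨆ w, (dist z w - f w)

/-- The average of `f` and its conjugate. -/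
noncomputable def distStep (f : X → ℝ) (z : X) : ℝ :=
  (f z + distConj f z) / 2

/-- Dress' canonical retraction of `Δ(X)` onto the extremal functions. -/
noncomputable def extremalRetract (f : X → ℝ) (z : X) : ℝ :=
  ⨅ k : ℕ, distStep^[k] f z

namespace DominatesDist

variable {f g : X → ℝ}

lemma nonneg (hf : DominatesDist f) (z : X) : 0 ≤ f z := by
  have := hf z z
  rw [dist_self] at this
  linarith

lemma le_distConj (hf : DominatesDist f) (z w : X) : dist z w - f w ≤ distConj f z := by
  refine le_ciSup (f := fun w => dist z w - f w) ⟨f z, ?_⟩ w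
  rintro _ ⟨w, rfl⟩
  have := hf z w
  simp only
  linarith

lemma distConj_le (hf : DominatesDist f) (z : X) : distConj f z ≤ f z := by
  have : Nonempty X := ⟨z⟩
  refine ciSup_le fun w => ?_
  have := hf z w
  linarith

/-- Conjugation reverses order; `hg` makes the supremum on the right a bounded one. -/
lemma distConj_le_add (hg : DominatesDist g) {c : ℝ} (h : ∀ w, g w ≤ f w + c) (z : X) :
    distConj f z ≤ distConj g z + c := by
  have : Nonempty X := ⟨z⟩
  refine ciSup_le fun w => ?_
  have := hg.le_distConj z w
  have := h w
  linarith

lemma step (hf : DominatesDist f) : DominatesDist (distStep f) := by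
  intro z w
  have h₁ := hf.le_distConj z w
  have h₂ := hf.le_distConj w z
  rw [dist_comm] at h₂
  unfold distStep
  linarith

lemma iterate (hf : DominatesDist f) (k : ℕ) : DominatesDist (distStep^[k] f) := by
  induction k with
  | zero => exact hf
  | succ k ih => rw [Function.iterate_succ_apply']; exact ih.step

lemma step_le (hf : DominatesDist f) (z : X) : distStep f z ≤ f z := by
  have := hf.distConj_le z
  unfold distStep
  linarith

lemma iterate_antitone (hf : DominatesDist f) (z : X) :
    Antitone fun k : ℕ => distStep^[k] f z := by
  refine antitone_nat_of_succ_le fun k => ?_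
  rw [Function.iterate_succ_apply']
  exact (hf.iterate k).step_le z

lemma bddBelow_iterate (hf : DominatesDist f) (z : X) :
    BddBelow (Set.range fun k : ℕ => distStep^[k] f z) := by
  refine ⟨0, ?_⟩
  rintro _ ⟨k, rfl⟩
  exact (hf.iterate k).nonneg z

lemma tendsto_iterate (hf : DominatesDist f) (z : X) :
    Filter.Tendsto (fun k : ℕ => distStep^[k] f z) Filter.atTop (nhds (extremalRetract f z)) :=
  tendsto_atTop_ciInf (hf.iterate_antitone z) (hf.bddBelow_iterate z)

lemma extremalRetract_le_iterate (hf : DominatesDist f) (k : ℕ) (z : X) :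
    extremalRetract f z ≤ distStep^[k] f z :=
  ciInf_le (hf.bddBelow_iterate z) k

lemma extremalRetract (hf : DominatesDist f) : DominatesDist (extremalRetract f) := fun z w =>
  ge_of_tendsto' ((hf.tendsto_iterate z).add (hf.tendsto_iterate w)) fun k => hf.iterate k z w

/-- A step replaces the function by the midpoint of it and its conjugate, and can only raise the
conjugate, so the gap at least halves. -/
lemma iterate_sub_distConj_le (hf : DominatesDist f) (z : X) (k : ℕ) :
    distStep^[k] f z - distConj (distStep^[k] f) z ≤ (f z - distConj f z) * (1 / 2) ^ k := by
  induction k with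
  | zero => simp
  | succ k ih =>
    rw [Function.iterate_succ_apply', pow_succ]
    have hk := hf.iterate k
    have h := distConj_le_add (f := distStep^[k] f) (c := 0) hk.step
      (fun w => by simpa using hk.step_le w) z
    have : distStep (distStep^[k] f) z
      = (distStep^[k] f z + distConj (distStep^[k] f) z) / 2 := rfl
    linarith

/-- The retraction takes values in extremal functions. -/
lemma extremalRetract_le_distConj (hf : DominatesDist f) (z : X) :
    _root_.extremalRetract f z ≤ distConj (_root_.extremalRetract f) z := by
  have hlim : Filter.Tendsto (fun k : ℕ => distConj (_root_.extremalRetract f) z +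
      (f z - distConj f z) * (1 / 2 : ℝ) ^ k) Filter.atTop
      (nhds (distConj (_root_.extremalRetract f) z + (f z - distConj f z) * 0)) :=
    ((tendsto_pow_atTop_nhds_zero_of_lt_one (by norm_num) (by norm_num)).const_mul _).const_add _
  rw [mul_zero, add_zero] at hlim
  refine le_of_tendsto_of_tendsto' (hf.tendsto_iterate z) hlim fun k => ?_
  have h₁ := hf.iterate_sub_distConj_le z k
  have h₂ := distConj_le_add (f := distStep^[k] f) (c := 0) hf.extremalRetract
    (fun w => by simpa using hf.extremalRetract_le_iterate k w) z
  linarith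

/-- Both bounds go through the induction together, since conjugation swaps them. -/
lemma iterate_le_add (hf : DominatesDist f) (hg : DominatesDist g) {c : ℝ}
    (hfg : ∀ z, f z ≤ g z + c) (hgf : ∀ z, g z ≤ f z + c) (k : ℕ) :
    (∀ z, distStep^[k] f z ≤ distStep^[k] g z + c) ∧
      ∀ z, distStep^[k] g z ≤ distStep^[k] f z + c := by
  induction k with
  | zero => exact ⟨hfg, hgf⟩
  | succ k ih =>
    simp only [Function.iterate_succ_apply']
    refine ⟨fun z => ?_, fun z => ?_⟩
    · have h₁ := ih.1 z
      have h₂ := (hg.iterate k).distConj_le_add ih.2 z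
      unfold distStep at h₁ h₂ ⊢
      linarith
    · have h₁ := ih.2 z
      have h₂ := (hf.iterate k).distConj_le_add ih.1 z
      unfold distStep at h₁ h₂ ⊢
      linarith

/-- The retraction is `1`-Lipschitz for the supremum distance. -/
lemma extremalRetract_le_add (hf : DominatesDist f) (hg : DominatesDist g) {c : ℝ}
    (hfg : ∀ z, f z ≤ g z + c) (hgf : ∀ z, g z ≤ f z + c) (z : X) :
    _root_.extremalRetract f z ≤ _root_.extremalRetract g z + c :=
  le_of_tendsto_of_tendsto' (hf.tendsto_iterate z) ((hg.tendsto_iterate z).add_const c)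
    fun k => (hf.iterate_le_add hg hfg hgf k).1 z

lemma comp_isometry (hf : DominatesDist f) {e : X → X} (he : Isometry e) :
    DominatesDist (f ∘ e) := fun z w => by
  rw [← he.dist_eq]
  exact hf _ _

end DominatesDist

lemma distConj_comp (f : X → ℝ) (e : X ≃ᵢ X) : distConj (f ∘ e) = distConj f ∘ e := by
  funext z
  exact e.toEquiv.iSup_congr fun w => by simp [e.isometry.dist_eq]

lemma distStep_iterate_comp (f : X → ℝ) (e : X ≃ᵢ X) (k : ℕ) :
    distStep^[k] (f ∘ e) = distStep^[k] f ∘ e := by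
  induction k with
  | zero => rfl
  | succ k ih =>
    rw [Function.iterate_succ_apply', Function.iterate_succ_apply', ih]
    funext z
    simp [distStep, distConj_comp]

lemma extremalRetract_comp (f : X → ℝ) (e : X ≃ᵢ X) :
    extremalRetract (f ∘ e) = extremalRetract f ∘ e := by
  funext z
  simp [extremalRetract, distStep_iterate_comp]

/-- The one-point extension of `X` in which the new point has distance `f z` to `z`. -/
@[reducible]
def onePointExtension (f : X → ℝ) (hf : DominatesDist f) (hpos : ∀ z, 0 < f z)
    (hlip : ∀ z w, f z ≤ f w + dist z w) : MetricSpace (Option X) where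
  dist
    | none, none => 0
    | none, some z => f z
    | some z, none => f z
    | some z, some w => dist z w
  dist_self a := by cases a <;> simp
  dist_comm a b := by cases a <;> cases b <;> simp [dist_comm]
  dist_triangle a b c := by
    rcases a with _ | a <;> rcases b with _ | b <;> rcases c with _ | c <;> simp only
    · simp
    · simp
    · linarith [hpos b]
    · linarith [hlip c b, dist_comm b c]
    · simp
    · exact hf a c
    · linarith [hlip a b]
    · exact dist_triangle a b c
  eq_of_dist_eq_zero {a b} h := by
    rcases a with _ | a <;> rcases b with _ | b <;> simp only at h
    · rfl
    · exact absurd h (hpos b).ne'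
    · exact absurd h (hpos a).ne'
    · rw [dist_eq_zero.1 h]

lemma IsInjectiveMetricSpace.nonempty (hX : IsInjectiveMetricSpace X) : Nonempty X := by
  let : MetricSpace PEmpty.{v + 1} := MetricSpace.induced (fun a => (a.elim : ℝ))
    (fun a => a.elim) inferInstance
  obtain ⟨g, -, -⟩ := hX PEmpty PUnit PEmpty.elim PEmpty.elim (fun a => a.elim) (fun a => a.elim)
  exact ⟨g PUnit.unit⟩

/-- In an injective space every extremal function is the distance to a point. -/
lemma IsInjectiveMetricSpace.exists_eq_dist (hX : IsInjectiveMetricSpace X) {f : X → ℝ}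
    (hf : DominatesDist f) (hext : ∀ z, f z ≤ distConj f z) : ∃ y, ∀ z, f z = dist y z := by
  have hlip : ∀ z w, f z ≤ f w + dist z w := fun z w => by
    have : Nonempty X := ⟨z⟩
    refine (hext z).trans (ciSup_le fun a => ?_)
    linarith [hf w a, dist_triangle z w a]
  suffices ∃ y, ∀ z, dist y z ≤ f z by
    obtain ⟨y, hy⟩ := this
    refine ⟨y, fun z => le_antisymm ?_ (hy z)⟩
    have : Nonempty X := ⟨z⟩
    refine (hext z).trans (ciSup_le fun a => ?_)
    linarith [hy a, dist_triangle z y a, dist_comm y z]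
  -- At a zero of `f` the added point would collide with an existing one, which then serves as `y`.
  by_cases h0 : ∃ y, f y = 0
  · obtain ⟨y, hy⟩ := h0
    exact ⟨y, fun z => by linarith [hf y z]⟩
  push Not at h0
  have hpos : ∀ z, 0 < f z := fun z => (hf.nonneg z).lt_of_ne' (h0 z)
  let := onePointExtension f hf hpos hlip
  obtain ⟨g, hg, hgi⟩ := hX X (Option X) some id (Isometry.of_dist_eq fun _ _ => rfl)
    LipschitzWith.id
  refine ⟨g none, fun z => ?_⟩
  have h := hg.dist_le_mul none (some z)
  have hz : g (some z) = z := congrFun hgi z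
  rw [hz, NNReal.coe_one, one_mul] at h
  exact h

/-- In an injective space the displacement of an isometry is at most its average displacement
along an orbit, up to moving the base point. -/
lemma IsInjectiveMetricSpace.exists_dist_le (hX : IsInjectiveMetricSpace X) (e : X ≃ᵢ X)
    (x : X) {n : ℕ} (hn : 0 < n) : ∃ y, dist y (e y) ≤ dist x ((e ^ n) x) / n := by
  have hn' : (0 : ℝ) < n := Nat.cast_pos.2 hn
  let F : X → ℝ := fun z => (∑ k ∈ Finset.range n, dist ((e ^ k) z) x) / n
  have hF : DominatesDist F := fun z w => by
    rw [← add_div, ← Finset.sum_add_distrib, le_div_iff₀ hn', mul_comm]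
    have : (n : ℝ) * dist z w = ∑ _k ∈ Finset.range n, dist z w := by simp
    rw [this]
    refine Finset.sum_le_sum fun k _ => ?_
    rw [← (e ^ k).isometry.dist_eq z w]
    exact dist_triangle_right _ _ _
  -- The sum telescopes, leaving only its two end terms.
  have hdiff : ∀ z, F (e z) - F z = (dist ((e ^ n) z) x - dist z x) / n := fun z => by
    have h := Finset.sum_range_sub (fun k => dist ((e ^ k) z) x) n
    rw [← sub_div, ← Finset.sum_sub_distrib]
    congr 1
  have hbound : ∀ z, |F (e z) - F z| ≤ dist x ((e ^ n) x) / n := fun z => by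
    rw [hdiff, abs_div, abs_of_pos hn']
    gcongr
    rw [← (e ^ n).isometry.dist_eq z x, dist_comm _ x, dist_comm ((e ^ n) z)]
    exact abs_dist_sub_le _ _ _
  obtain ⟨y, hy⟩ := hX.exists_eq_dist hF.extremalRetract hF.extremalRetract_le_distConj
  refine ⟨y, ?_⟩
  have h := (hF.comp_isometry e.isometry).extremalRetract_le_add hF
    (fun z => by have := (abs_le.1 (hbound z)).2; simp only [Function.comp]; linarith)
    (fun z => by have := (abs_le.1 (hbound z)).1; simp only [Function.comp]; linarith) y
  rw [extremalRetract_comp, Function.comp, hy, hy, dist_self, zero_add] at h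
  exact h

end InjectiveHull

/-! ### Small displacement under geometric actions -/

section GeometricAction

variable {G : Type u} [Group G] {X : Type v} [MetricSpace X] {Φ : G →* (X ≃ᵢ X)}

lemma IsProperIsometricAction.isOfFinOrder_of_fixed (hΦ : IsProperIsometricAction Φ) {g : G}
    {x : X} (hg : Φ g x = x) : IsOfFinOrder g := by
  obtain ⟨r, hr, hfin⟩ := hΦ x
  have hpow : ∀ k : ℕ, Φ (g ^ k) x = x := fun k => by
    induction k with
    | zero => simp
    | succ k ih => rw [pow_succ, map_mul, IsometryEquiv.mul_apply, hg, ih]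
  rw [← finite_powers]
  refine hfin.subset ?_
  rintro _ ⟨k, rfl⟩
  exact ⟨x, ⟨x, Metric.mem_ball_self hr, hpow k⟩, Metric.mem_ball_self hr⟩

/-- Near a given point, elements with small displacement have finite order. -/
lemma IsProperIsometricAction.exists_local_bound (hΦ : IsProperIsometricAction Φ) (x : X) :
    ∃ δ > 0, ∀ z ∈ Metric.ball x δ, ∀ g : G, dist z (Φ g z) < δ → IsOfFinOrder g := by
  obtain ⟨r, hr, hfin⟩ := hΦ x
  set S := {g : G | ((Φ g '' Metric.ball x r) ∩ Metric.ball x r).Nonempty}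
  -- The factor `3` pays for the path `x`, `z`, `g z`, `g x`; finiteness of `S` gives one `δ` for
  -- all `g`.
  have hev : ∀ᶠ δ : ℝ in nhdsWithin 0 (Set.Ioi 0),
      ∀ g ∈ S, Φ g x ≠ x → 3 * δ ≤ dist x (Φ g x) := by
    rw [Filter.eventually_all_finite hfin]
    intro g _
    by_cases h : Φ g x = x
    · exact Filter.Eventually.of_forall fun _ h' => absurd h h'
    · have hpos : 0 < dist x (Φ g x) := dist_pos.2 (Ne.symm h)
      filter_upwards [Ioo_mem_nhdsGT (show (0 : ℝ) < dist x (Φ g x) / 3 by positivity)]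
        with δ hδ _
      linarith [hδ.2]
  obtain ⟨δ, hδ, hδ₀, hδr⟩ :=
    (hev.and (Ioo_mem_nhdsGT (show (0 : ℝ) < r / 2 by positivity))).exists
  refine ⟨δ, hδ₀, fun z hz g hg => ?_⟩
  have hzx : dist z x < δ := hz
  have hgS : g ∈ S := by
    refine ⟨Φ g z, ⟨z, ?_, rfl⟩, ?_⟩
    · exact Metric.mem_ball.2 (by linarith)
    · refine Metric.mem_ball.2 ?_
      linarith [dist_triangle_left (Φ g z) x z]
  refine hΦ.isOfFinOrder_of_fixed (x := x) ?_
  by_contra hne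
  have h₁ := hδ g hgS hne
  have h₂ := dist_triangle4 x z (Φ g z) (Φ g x)
  rw [(Φ g).isometry.dist_eq, dist_comm x z] at h₂
  linarith

/-- Elements of uniformly small displacement have finite order. -/
lemma IsGeometricAction.exists_bound (hΦ : IsGeometricAction Φ) :
    ∃ δ > 0, ∀ (z : X) (g : G), dist z (Φ g z) < δ → IsOfFinOrder g := by
  obtain ⟨hprop, K, hK, hcov⟩ := hΦ
  have hKδ : ∃ δ > 0, ∀ z ∈ K, ∀ g : G, dist z (Φ g z) < δ → IsOfFinOrder g := by
    refine hK.induction_on (p := fun s => ∃ δ > 0, ∀ z ∈ s, ∀ g : G, dist z (Φ g z) < δ →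
      IsOfFinOrder g) ⟨1, one_pos, by simp⟩ ?_ ?_ ?_
    · rintro s t hst ⟨δ, hδ, h⟩
      exact ⟨δ, hδ, fun z hz => h z (hst hz)⟩
    · rintro s t ⟨δ, hδ, h⟩ ⟨ε, hε, h'⟩
      refine ⟨min δ ε, lt_min hδ hε, fun z hz g hg => ?_⟩
      rcases hz with hz | hz
      · exact h z hz g (hg.trans_le (min_le_left _ _))
      · exact h' z hz g (hg.trans_le (min_le_right _ _))
    · intro x _
      obtain ⟨δ, hδ, h⟩ := hprop.exists_local_bound x
      exact ⟨Metric.ball x δ, mem_nhdsWithin_of_mem_nhds (Metric.ball_mem_nhds x hδ), δ, hδ, h⟩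
  obtain ⟨δ, hδ, h⟩ := hKδ
  refine ⟨δ, hδ, fun z g hg => ?_⟩
  -- Conjugating by `a` moves the base point into `K` and preserves both displacement and order.
  obtain ⟨a, k, hk, rfl⟩ : ∃ a, z ∈ Φ a '' K := Set.mem_iUnion.1 (hcov ▸ Set.mem_univ z)
  have hconj : IsOfFinOrder (a⁻¹ * g * a) := by
    refine h k hk _ ?_
    rw [← (Φ a).isometry.dist_eq, ← IsometryEquiv.mul_apply (Φ a), ← map_mul]
    simpa [mul_assoc] using hg
  have : g = MulAut.conj a (a⁻¹ * g * a) := by simp [mul_assoc]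
  rw [this]
  exact (MulAut.conj a).toMonoidHom.isOfFinOrder hconj

end GeometricAction

/-! ### Almost divisible subgroups -/

lemma IsMetricallyInjective.isMulTorsion {G : Type u} [Group G]
    (hG : IsMetricallyInjective.{u, v} G) (H : Subgroup G) (hH : IsAlmostDivisible H) :
    IsMulTorsion H := by
  obtain ⟨X, _, Φ, hX, hΦ⟩ := hG
  obtain ⟨δ, hδ, hfin⟩ := hΦ.exists_bound
  obtain ⟨x⟩ := hX.nonempty
  obtain ⟨n, hn, hdiv⟩ := hH
  intro h
  obtain ⟨N, hN⟩ := exists_nat_gt (dist x (Φ h x) / δ)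
  obtain ⟨_, ⟨i, rfl⟩, hi⟩ := not_bddAbove_iff.1 hn N
  obtain ⟨hpos, hroot⟩ := hdiv i
  obtain ⟨d, rfl⟩ := hroot h
  have hpos' : (0 : ℝ) < n i := Nat.cast_pos.2 hpos
  obtain ⟨y, hy⟩ := hX.exists_dist_le (Φ d) x hpos
  have hd : IsOfFinOrder (d : G) := by
    refine hfin y d (hy.trans_lt ?_)
    rw [div_lt_comm₀ hpos' hδ, ← map_pow, ← Subgroup.coe_pow]
    exact hN.trans (Nat.cast_lt.2 hi)
  exact (Submonoid.isOfFinOrder_coe.1 hd).pow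

lemma isAlmostDivisible_of_mulEquiv {H : Type u} {K : Type v} [Group H] [Group K] (e : H ≃* K)
    (hK : IsAlmostDivisible K) : IsAlmostDivisible H := by
  obtain ⟨n, hn, hdiv⟩ := hK
  refine ⟨n, hn, fun i => ⟨(hdiv i).1, fun g => ?_⟩⟩
  obtain ⟨d, hd⟩ := (hdiv i).2 (e g)
  exact ⟨e.symm d, by rw [← map_pow, hd, e.symm_apply_apply]⟩

/-- The additive group of a ring with units among arbitrarily large natural numbers is almost
divisible. -/
lemma isAlmostDivisible_multiplicative {R : Type u} [Ring R] (n : ℕ → ℕ)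
    (hn : ¬ BddAbove (Set.range n)) (hpos : ∀ i, 0 < n i) (hunit : ∀ i, IsUnit (n i : R)) :
    IsAlmostDivisible (Multiplicative R) := by
  refine ⟨n, hn, fun i => ⟨hpos i, fun g => ?_⟩⟩
  obtain ⟨v, hv⟩ := hunit i
  refine ⟨Multiplicative.ofAdd ((↑v⁻¹ : R) * g.toAdd), ?_⟩
  rw [← ofAdd_nsmul, nsmul_eq_mul, ← hv, Units.mul_inv_cancel_left, ofAdd_toAdd]

lemma not_isMulTorsion_of_mulEquiv {H : Type u} {R : Type v} [Group H] [Ring R] [CharZero R]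
    (e : H ≃* Multiplicative R) : ¬ IsMulTorsion H := by
  intro h
  have h₁ := e.toMonoidHom.isOfFinOrder (h (e.symm (Multiplicative.ofAdd 1)))
  obtain ⟨n, hn, h₂⟩ := isOfFinOrder_iff_pow_eq_one.1 h₁
  have h₃ : Multiplicative.ofAdd (1 : R) ^ n = 1 := by simpa using h₂
  rw [← ofAdd_nsmul, ofAdd_eq_one, nsmul_one, Nat.cast_eq_zero] at h₃
  omega

/-- The exponents `p * i + 1` are prime to `p`, hence units of `ℤ_[p]`; `p = 1` serves for `ℚ`. -/
lemma not_bddAbove_range_mul_add_one {p : ℕ} (hp : 0 < p) :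
    ¬ BddAbove (Set.range fun i : ℕ => p * i + 1) := by
  refine not_bddAbove_iff.2 fun N => ⟨p * N + 1, ⟨N, rfl⟩, ?_⟩
  exact Nat.lt_succ_of_le (Nat.le_mul_of_pos_left N hp)

lemma PadicInt.isUnit_natCast_mul_add_one (p : ℕ) [Fact p.Prime] (i : ℕ) :
    IsUnit ((p * i + 1 : ℕ) : ℤ_[p]) := by
  rw [PadicInt.isUnit_iff]
  rw [PadicInt.norm_natCast_eq_one_iff]
  simp

theorem mainTheorem8 (G : Type u) [Group G] (hG : IsMetricallyInjective.{u, v} G) :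
    (∀ H : Subgroup G, IsAlmostDivisible H → IsMulTorsion H) ∧
    (¬ ∃ H : Subgroup G, Nonempty (H ≃* Multiplicative ℚ)) ∧
    (∀ (p : ℕ) [Fact p.Prime], ¬ ∃ H : Subgroup G, Nonempty (H ≃* Multiplicative ℤ_[p])) := by
  refine ⟨hG.isMulTorsion, ?_, ?_⟩
  · rintro ⟨H, ⟨e⟩⟩
    refine not_isMulTorsion_of_mulEquiv e (hG.isMulTorsion H (isAlmostDivisible_of_mulEquiv e ?_))
    exact isAlmostDivisible_multiplicative _ (not_bddAbove_range_mul_add_one one_pos)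
      (fun i => Nat.succ_pos _) fun i => (Nat.cast_ne_zero.2 (Nat.succ_ne_zero _)).isUnit
  · rintro p _ ⟨H, ⟨e⟩⟩
    refine not_isMulTorsion_of_mulEquiv e (hG.isMulTorsion H (isAlmostDivisible_of_mulEquiv e ?_))
    exact isAlmostDivisible_multiplicative _
      (not_bddAbove_range_mul_add_one (Fact.out : p.Prime).pos)
      (fun i => Nat.succ_pos _) (PadicInt.isUnit_natCast_mul_add_one p)
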